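/- All graphs are finite and simple. A connected graph with $n$ vertices and $n+c-1$ edges is called a tree, a unicyclic graph or a bicyclic graph when $c=0$, $1$ or $2$, respectively. A pendant vertex is a vertex of degree $1$. A symmetric function $f(x,y)$ on the positive reals is called \emph{escalating} if $f(x_1,x_2)+f(y_1,y_2)\ge f(x_2,y_1)+f(x_1,y_2)$ for all $x_1\ge y_1>0$ and $x_2\ge y_2>0$, with strict inequality if $x_1>y_1$ and $x_2>y_2$. It is called \emph{good escalating} if moreover it is twice differentiable in $x$ with $\frac{\partial f}{\partial x}>0$ and $\frac{\partial^2 f}{\partial x^2}\ge 0$ on the positive reals, and $f(x_1+1,x_2)+f(x_1+1,y_1-1)\ge f(x_2,y_1)+f(x_1,y_1)$ for all reals $x_1\ge y_1>1$ and $x_2\ge 1$. For a graph $G$ put $M_f(G)=\sum_{uv\in E(G)} f(d(u),d(v))$, where $d(v)$ is the degree of $v$. For an escalating $f$, a graph in a class of graphs is \emph{extremal} in that class if it maximizes $M_f$ over the class. Write $P_l$ for the path with $l$ vertices. Attaching the paths $P_{l_1},\dots,P_{l_k}$ to a vertex $r$ means joining $r$ by an edge to one end vertex of each of them; the paths have almost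 equal lengths if $l_i\ge 1$ and $|l_i-l_j|\le 1$ for all $i,j$. Let $B_2$ be the bicyclic graph on five vertices that consists of two triangles sharing one vertex, and let $C_3$ be the triangle. Let $f$ be good escalating and let $k\ge 1$ and $n$ be integers. (i) If $n\ge k+5$, let $F''_n(k)$ be the graph on $n$ vertices obtained by attaching $k$ paths of almost equal lengths to the vertex of degree four of $B_2$. This graph exists and is extremal among all bicyclic graphs with $n$ vertices and $k$ pendant vertices. (ii) If $n\ge k+3$, let $F'_n(k)$ be the graph on $n$ vertices obtained by attaching $k$ paths of almost equal lengths to one vertex of $C_3$. This graph exists and is extremal among all unicyclic graphs with $n$ vertices and $k$ pendant vertices. (iii) If $k\ge 2$ and $n\ge k+1$, let $F_n(k)$ be the graph on $n$ vertices obtained by attaching $k$ paths of almost equal lengths to an isolated vertex. This graph exists and is extremal among all trees with $n$ vertices and $k$ pendant vertices. In each case the extremal graph belongs to the class in question. -/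

import Mathlib

open scoped BigOperators

/-- `f` is *escalating*: a symmetric function of two positive real variables with the (strict)
rearrangement inequality. Only the values of `f` at positive arguments matter: a symmetric function
on the positive reals is represented by any symmetric extension of it, such as the one by `0`. -/
structure IsEscalating (f : ℝ → ℝ → ℝ) : Prop where
  symm : ∀ x y : ℝ, f x y = f y x
  ineq : ∀ x₁ y₁ x₂ y₂ : ℝ, 0 < y₁ → y₁ ≤ x₁ → 0 < y₂ → y₂ ≤ x₂ →
    f x₂ y₁ + f x₁ y₂ ≤ f x₁ x₂ + f y₁ y₂
  strict : ∀ x₁ y₁ x₂ y₂ : ℝ, 0 < y₁ → y₁ < x₁ → 0 < y₂ → y₂ < x₂ →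
    f x₂ y₁ + f x₁ y₂ < f x₁ x₂ + f y₁ y₂

/-- `f` is *good escalating*: escalating, twice differentiable in the first variable on the positive
reals with `∂f/∂x > 0` and `∂²f/∂x² ≥ 0`, and subject to one further inequality, which is required
whenever all its arguments are positive (that is, for `y₁ > 1`). -/
structure IsGoodEscalating (f : ℝ → ℝ → ℝ) : Prop extends IsEscalating f where
  differentiable : ∀ x y : ℝ, 0 < x → 0 < y → DifferentiableAt ℝ (fun t => f t y) x
  deriv_pos : ∀ x y : ℝ, 0 < x → 0 < y → 0 < deriv (fun t => f t y) x
  differentiable_deriv : ∀ x y : ℝ, 0 < x → 0 < y →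
    DifferentiableAt ℝ (deriv (fun t => f t y)) x
  deriv_deriv_nonneg : ∀ x y : ℝ, 0 < x → 0 < y → 0 ≤ deriv (deriv (fun t => f t y)) x
  shift : ∀ x₁ y₁ x₂ : ℝ, 1 < y₁ → y₁ ≤ x₁ → 1 ≤ x₂ →
    f x₂ y₁ + f x₁ y₁ ≤ f (x₁ + 1) x₂ + f (x₁ + 1) (y₁ - 1)

open Classical in
/-- The connectivity function `M_f(G) = ∑_{uv ∈ E(G)} f (d(u), d(v))`. -/
noncomputable def connectivityFunction (f : ℝ → ℝ → ℝ) (hf : ∀ x y : ℝ, f x y = f y x)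
    {V : Type*} [Fintype V] (G : SimpleGraph V) : ℝ :=
  ∑ e ∈ G.edgeFinset,
    Sym2.lift ⟨fun u v : V => f (G.degree u : ℝ) (G.degree v : ℝ), fun _ _ => hf _ _⟩ e

open Classical in
/-- A `c`-cyclic graph: a connected graph with `m = n + c - 1` edges, `n` being the number of
vertices. Trees, unicyclic graphs and bicyclic graphs are the cases `c = 0`, `1` and `2`. -/
def IsCyclicGraph (c : ℕ) {V : Type*} [Fintype V] (G : SimpleGraph V) : Prop :=
  G.Connected ∧ G.edgeFinset.card + 1 = Fintype.card V + c

open Classical in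
/-- The number of pendant vertices (vertices of degree `1`). -/
noncomputable def pendantCount {V : Type*} [Fintype V] (G : SimpleGraph V) : ℕ :=
  (Finset.univ.filter fun v : V => G.degree v = 1).card

/-- `G` is a `c`-cyclic graph with `n` vertices and `k` pendant vertices. -/
def InClass (c n k : ℕ) {V : Type*} [Fintype V] (G : SimpleGraph V) : Prop :=
  IsCyclicGraph c G ∧ Fintype.card V = n ∧ pendantCount G = k

/-- `G` is an extremal graph, for the escalating function `f`, among the `c`-cyclic graphs with `n`
vertices and `k` pendant vertices: it is one of them, and it maximizes `M_f` among them. -/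
def IsExtremalGraph {f : ℝ → ℝ → ℝ} (hf : IsEscalating f) (c n k : ℕ)
    {V : Type*} [Fintype V] (G : SimpleGraph V) : Prop :=
  InClass c n k G ∧
    ∀ (W : Type) [Fintype W] (H : SimpleGraph W), InClass c n k H →
      connectivityFunction f hf.symm H ≤ connectivityFunction f hf.symm G

/-- The graph obtained from `H` by attaching, for each `i : Fin k`, a path with `l i` vertices
to the vertex `r`: an end vertex of each path is joined to `r` by an edge. -/
def attachPaths {V : Type*} (H : SimpleGraph V) (r : V) {k : ℕ} (l : Fin k → ℕ) :
    SimpleGraph (V ⊕ (Σ i : Fin k, Fin (l i))) where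
  Adj x y := match x, y with
    | .inl u, .inl v => H.Adj u v
    | .inl u, .inr q => u = r ∧ q.2.val = 0
    | .inr p, .inl v => v = r ∧ p.2.val = 0
    | .inr p, .inr q => p.1 = q.1 ∧ (p.2.val + 1 = q.2.val ∨ q.2.val + 1 = p.2.val)
  symm := ⟨by
    rintro (u | p) (v | q) h
    · exact SimpleGraph.Adj.symm h
    · exact h
    · exact h
    · exact ⟨h.1.symm, h.2.symm⟩⟩
  loopless := ⟨by
    rintro (u | p) h
    · exact H.loopless.irrefl u h
    · obtain ⟨-, h | h⟩ := h <;> omega⟩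

/-- `l` lists the numbers of vertices of `k` (nonempty) paths of almost equal lengths. -/
def AlmostEqualLengths {k : ℕ} (l : Fin k → ℕ) : Prop :=
  (∀ i, 1 ≤ l i) ∧ ∀ i j, |(l i : ℤ) - (l j : ℤ)| ≤ 1

/-- The bicyclic graph `B₂`: two triangles `{0, 1, 2}` and `{0, 3, 4}` sharing the vertex `0`. -/
def bowtie : SimpleGraph (Fin 5) :=
  SimpleGraph.fromEdgeSet {s(0, 1), s(0, 2), s(1, 2), s(0, 3), s(0, 4), s(3, 4)}

/-!
Subtract from `f (d u) (d v)` the values obtained by replacing one degree at a time by `2`. What is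
left is an interaction that vertices of degree `2` do not take part in, and the remaining terms
depend on one degree each. Hence, up to a quantity determined by `c`, `n` and `k`, the connectivity
function is an energy: a sum of hub weights over the nonpendant vertices, plus the interactions of
adjacent ones. Merging two nonpendant vertices of degrees `2 + p` and `2 + q` into one of degree
`2 + p + q` does not decrease the energy, as long as the new vertex keeps enough nonpendant
neighbours.

A `c`-cyclic graph with `c ≤ 2` is sparse enough for its nonpendant vertices to be merged one at a
time, each of them being adjacent to at most two of those already merged, and outside the core to
at most one. The exception is a core that is `K₄` minus an edge, where the two vertices of degree
three are merged first. This ends in a single hub of degree `k + 2 * c` whose number of nonpendant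
neighbours is at most `k + 2 * c` and at most the number of nonpendant vertices minus one. In the
graph of the theorem there is only the hub to begin with, and since the attached paths have almost
equal lengths it attains one of these two bounds.
-/

/-! ### Escalating functions on the natural numbers -/

/-- The discrete form of an escalating function: symmetric, and with nonnegative mixed differences
at the positive integers, no strictness being asked for. -/
structure IsDiscreteEscalating (g : ℕ → ℕ → ℝ) : Prop where
  symm : ∀ x y, g x y = g y x
  supermodular : ∀ x x' y y', 0 < x → x ≤ x' → 0 < y → y ≤ y' →
    g x y' + g x' y ≤ g x' y' + g x y

/-- The discrete form of a good escalating function. Degrees are integers, so this is all that the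
connectivity function can see; monotonicity and convexity in the first variable replace the
conditions on the derivatives. -/
structure IsDiscreteGoodEscalating (g : ℕ → ℕ → ℝ) : Prop extends IsDiscreteEscalating g where
  monotone : ∀ x x' y, 0 < x → x ≤ x' → 0 < y → g x y ≤ g x' y
  convex : ∀ x y, 0 < x → 0 < y → g (x + 1) y - g x y ≤ g (x + 2) y - g (x + 1) y
  shift : ∀ x y z, 0 < y → y < x → 0 < z →
    g z (y + 1) + g x (y + 1) ≤ g (x + 1) z + g (x + 1) y

/-- The restriction of `f` to natural numbers, which is all that degrees see of it. -/
def natRestriction (f : ℝ → ℝ → ℝ) : ℕ → ℕ → ℝ := fun x y => f x y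

namespace IsGoodEscalating

variable {f : ℝ → ℝ → ℝ}

theorem convexOn (hf : IsGoodEscalating f) {y : ℝ} (hy : 0 < y) :
    ConvexOn ℝ (Set.Ioi 0) fun t => f t y := by
  refine convexOn_of_deriv2_nonneg (convex_Ioi 0)
    (fun x hx => (hf.differentiable x y hx hy).continuousAt.continuousWithinAt) ?_ ?_ ?_ <;>
    rw [interior_Ioi]
  · exact fun x hx => (hf.differentiable x y hx hy).differentiableWithinAt
  · exact fun x hx => (hf.differentiable_deriv x y hx hy).differentiableWithinAt
  · exact fun x hx => hf.deriv_deriv_nonneg x y hx hy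

theorem strictMonoOn (hf : IsGoodEscalating f) {y : ℝ} (hy : 0 < y) :
    StrictMonoOn (fun t => f t y) (Set.Ioi 0) := by
  refine strictMonoOn_of_deriv_pos (convex_Ioi 0)
    (fun x hx => (hf.differentiable x y hx hy).continuousAt.continuousWithinAt) fun x hx => ?_
  rw [interior_Ioi] at hx
  exact hf.deriv_pos x y hx hy

theorem discrete (hf : IsGoodEscalating f) : IsDiscreteGoodEscalating (natRestriction f) where
  symm x y := hf.symm x y
  supermodular x x' y y' hx hxx hy hyy := by
    have := hf.ineq x' x y' y (by exact_mod_cast hx) (by exact_mod_cast hxx)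
      (by exact_mod_cast hy) (by exact_mod_cast hyy)
    rwa [hf.symm y' x] at this
  monotone x x' y hx hxx hy :=
    (hf.strictMonoOn (Nat.cast_pos.2 hy)).monotoneOn (Set.mem_Ioi.2 (Nat.cast_pos.2 hx))
      (Set.mem_Ioi.2 (Nat.cast_pos.2 (hx.trans_le hxx))) (Nat.cast_le.2 hxx)
  convex x y hx hy := by
    have hx' : (0 : ℝ) < x := Nat.cast_pos.2 hx
    have midpoint := (hf.convexOn (Nat.cast_pos.2 hy)).2 (Set.mem_Ioi.2 hx')
      (Set.mem_Ioi.2 (show (0 : ℝ) < x + 2 by linarith)) (by norm_num : (0 : ℝ) ≤ 1 / 2)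
      (by norm_num : (0 : ℝ) ≤ 1 / 2) (by norm_num)
    simp only [smul_eq_mul] at midpoint
    rw [show 1 / 2 * (x : ℝ) + 1 / 2 * (x + 2) = x + 1 by ring] at midpoint
    simp only [natRestriction, Nat.cast_add, Nat.cast_one, Nat.cast_ofNat]
    linarith
  shift x y z hy hyx hz := by
    have hy' : (0 : ℝ) < y := Nat.cast_pos.2 hy
    have := hf.shift x (y + 1) z (by linarith) (by exact_mod_cast hyx) (by exact_mod_cast hz)
    simp only [natRestriction, Nat.cast_add, Nat.cast_one]
    rwa [add_sub_cancel_right] at this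

end IsGoodEscalating

/-- The excess of `g x y` over the value obtained by replacing one argument at a time by `2`, so
that vertices of degree `2` interact with nothing. -/
def interaction (g : ℕ → ℕ → ℝ) (x y : ℕ) : ℝ := g x y - g x 2 - g y 2 + g 2 2

/-- The normalized contribution of a hub: a vertex of degree `x` with `a` neighbours of degree `2`
and `x - a` pendant neighbours, `g 2 2 - g 2 1` compensating for each path of length one. It is
linear in `a`, which is therefore allowed to be any real number. -/
def hubWeight (g : ℕ → ℕ → ℝ) (x : ℕ) (a : ℝ) : ℝ :=
  a * g x 2 + (x - a) * (g x 1 + (g 2 2 - g 2 1))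

theorem interaction_two_right (g : ℕ → ℕ → ℝ) (x : ℕ) : interaction g x 2 = 0 := by
  simp only [interaction]; ring

theorem hubWeight_two (g : ℕ → ℕ → ℝ) (a : ℝ) : hubWeight g 2 a = 2 * g 2 2 := by
  simp only [hubWeight, Nat.cast_ofNat]; ring

namespace IsDiscreteEscalating

variable {g : ℕ → ℕ → ℝ}

theorem interaction_comm (hg : IsDiscreteEscalating g) (x y : ℕ) :
    interaction g x y = interaction g y x := by
  simp only [interaction, hg.symm x y]; ring

theorem interaction_two_left (hg : IsDiscreteEscalating g) (y : ℕ) : interaction g 2 y = 0 := by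
  rw [hg.interaction_comm, interaction_two_right]

theorem interaction_mono_left (hg : IsDiscreteEscalating g) {x x' y : ℕ} (hx : 0 < x)
    (hxx : x ≤ x') (hy : 2 ≤ y) : interaction g x y ≤ interaction g x' y := by
  have := hg.supermodular x x' 2 y hx hxx two_pos hy
  simp only [interaction]; linarith

theorem interaction_nonneg (hg : IsDiscreteEscalating g) {x y : ℕ} (hx : 2 ≤ x) (hy : 2 ≤ y) :
    0 ≤ interaction g x y :=
  (hg.interaction_two_left y).ge.trans (hg.interaction_mono_left two_pos hx hy)

theorem hubWeight_mono (hg : IsDiscreteEscalating g) {x : ℕ} (hx : 2 ≤ x) :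
    Monotone (hubWeight g x) := by
  intro a b hab
  have slope_nonneg := hg.supermodular 2 x 1 2 two_pos hx one_pos one_le_two
  have := mul_nonneg (sub_nonneg.2 hab)
    (show 0 ≤ g x 2 - (g x 1 + (g 2 2 - g 2 1)) by linarith)
  simp only [hubWeight]; linarith

theorem one_increment_le_two_increment (hg : IsDiscreteEscalating g) {x : ℕ} (hx : 0 < x) (p : ℕ) :
    g (x + p) 1 - g x 1 ≤ g (x + p) 2 - g x 2 := by
  linarith [hg.supermodular x (x + p) 1 2 hx (Nat.le_add_right x p) one_pos one_le_two]

end IsDiscreteEscalating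

theorem sum_range_add_sub_comm {M : Type*} [AddCommGroup M] (h : ℕ → M) (p q : ℕ) :
    ∑ i ∈ Finset.range q, (h (p + i) - h i) = ∑ j ∈ Finset.range p, (h (q + j) - h j) := by
  have hpq := Finset.sum_range_add h p q
  rw [add_comm p q, Finset.sum_range_add] at hpq
  rw [Finset.sum_sub_distrib, Finset.sum_sub_distrib, sub_eq_sub_iff_add_eq_add]
  rw [add_comm, ← hpq, add_comm]

/-- An upper bound for the change in `g` caused by moving all but two neighbours of a vertex of
degree `2 + q` to an adjacent vertex of degree `2 + p`. It is symmetric in `p` and `q` by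
`sum_range_add_sub_comm`. -/
def shiftCost (g : ℕ → ℕ → ℝ) (p q : ℕ) : ℝ :=
  ∑ i ∈ Finset.range q, (g (3 + (p + i)) 1 - g (3 + i) 1)

theorem shiftCost_comm (g : ℕ → ℕ → ℝ) (p q : ℕ) : shiftCost g p q = shiftCost g q p :=
  sum_range_add_sub_comm (fun i => g (3 + i) 1) p q

namespace IsDiscreteGoodEscalating

variable {g : ℕ → ℕ → ℝ}

theorem unit_increment_mono (hg : IsDiscreteGoodEscalating g) {a b y : ℕ} (hy : 0 < y)
    (ha : 0 < a) (hab : a ≤ b) : g (a + 1) y - g a y ≤ g (b + 1) y - g b y := by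
  induction b, hab using Nat.le_induction with
  | base => rfl
  | succ b hab ih => exact ih.trans (hg.convex b y (ha.trans_le hab) hy)

theorem increment_mono (hg : IsDiscreteGoodEscalating g) {a b y : ℕ} (hy : 0 < y)
    (ha : 0 < a) (hab : a ≤ b) (p : ℕ) :
    g (a + p) y - g a y ≤ g (b + p) y - g b y := by
  have telescope (c : ℕ) := Finset.sum_range_sub (fun i => g (c + i) y) p
  simp only [add_zero] at telescope
  rw [← telescope, ← telescope]
  exact Finset.sum_le_sum fun i _ =>
    hg.unit_increment_mono hy (Nat.add_pos_left ha i) (Nat.add_le_add_right hab i)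

theorem shiftCost_le (hg : IsDiscreteGoodEscalating g) (p q : ℕ) :
    shiftCost g p q ≤ q * (g (2 + p + q) 1 - g (2 + q) 1) := by
  rw [← nsmul_eq_mul]
  refine (Finset.sum_le_card_nsmul _ _ _ fun i hi => ?_).trans_eq (by rw [Finset.card_range])
  have hiq : 3 + i ≤ 2 + q := by have := Finset.mem_range.1 hi; omega
  have := hg.increment_mono one_pos (by omega) hiq p
  rwa [show 3 + i + p = 3 + (p + i) by omega, show 2 + q + p = 2 + p + q by omega] at this

theorem le_add_shiftCost (hg : IsDiscreteGoodEscalating g) (p q : ℕ) :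
    g (2 + p) (2 + q) ≤ g (2 + p + q) 2 + shiftCost g p q := by
  have of_le : ∀ q p : ℕ, q ≤ p → g (2 + p) (2 + q) ≤ g (2 + p + q) 2 + shiftCost g p q := by
    intro q
    induction q with
    | zero => simp [shiftCost]
    | succ q ih =>
      intro p hqp
      have move_one := hg.shift (2 + p) (2 + q) 1 (by omega) (by omega) one_pos
      have move_rest := ih (p + 1) (by omega)
      rw [hg.symm 1] at move_one
      rw [shiftCost, Finset.sum_sub_distrib] at move_rest ⊢
      rw [Finset.sum_range_succ', Finset.sum_range_succ]
      ring_nf at move_one move_rest ⊢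
      linarith
  rcases le_total q p with hqp | hpq
  · exact of_le q p hqp
  · have := of_le p q hpq
    rwa [hg.symm, shiftCost_comm, show 2 + q + p = 2 + p + q by omega] at this

theorem hubWeight_merge (hg : IsDiscreteGoodEscalating g) {t : ℕ} (ht : t = 1 ∨ t = 2)
    (p q : ℕ) {a b : ℝ} (ha : t ≤ a) (hb : t ≤ b) :
    t * interaction g (2 + p) (2 + q) + hubWeight g (2 + p) a + hubWeight g (2 + q) b ≤
      hubWeight g (2 + p + q) (a + b - t) + 2 * g 2 2 := by
  have comm : 2 + q + p = 2 + p + q := by omega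
  have merge := hg.le_add_shiftCost p q
  have cost_p := (shiftCost_comm g p q).trans_le (hg.shiftCost_le q p)
  have slope_p := mul_le_mul_of_nonneg_left
    (hg.one_increment_le_two_increment (x := 2 + p) (by omega) q) (sub_nonneg.2 ha)
  have slope_q := mul_le_mul_of_nonneg_left
    (hg.one_increment_le_two_increment (x := 2 + q) (by omega) p) (sub_nonneg.2 hb)
  rw [comm] at cost_p slope_q
  simp only [interaction, hubWeight]
  rcases ht with rfl | rfl <;> push_cast at slope_p slope_q ⊢
  · have increment := hg.increment_mono one_pos two_pos (Nat.le_add_right 2 q) p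
    have gain_q : 0 ≤ (q : ℝ) * (g (2 + p + q) 1 - g (2 + q) 1) := mul_nonneg q.cast_nonneg
      (sub_nonneg.2 (hg.monotone _ _ _ (by omega) (by omega) one_pos))
    rw [comm] at increment
    linear_combination merge + cost_p + slope_p + slope_q + gain_q + increment
  · linear_combination 2 * merge + hg.shiftCost_le p q + cost_p + slope_p + slope_q

theorem hubWeight_merge_of_three_le (hg : IsDiscreteGoodEscalating g) (p : ℕ) {q : ℕ}
    (hq : 1 ≤ q) {a b : ℝ} (ha : 3 ≤ a) (hb : 3 ≤ b) :
    interaction g (2 + p) (2 + q) + hubWeight g (2 + p) a + hubWeight g (2 + q) b ≤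
      hubWeight g (2 + p + q) (a + b - 3) + 2 * g 2 2 := by
  have comm : 2 + q + p = 2 + p + q := by omega
  have slope_p := mul_le_mul_of_nonneg_left
    (hg.one_increment_le_two_increment (x := 2 + p) (by omega) q) (sub_nonneg.2 ha)
  have slope_q := mul_le_mul_of_nonneg_left
    (hg.one_increment_le_two_increment (x := 2 + q) (by omega) p) (sub_nonneg.2 hb)
  have gain_q : 0 ≤ ((q : ℝ) - 1) * (g (2 + p + q) 1 - g (2 + q) 1) :=
    mul_nonneg (sub_nonneg.2 (by exact_mod_cast hq))
      (sub_nonneg.2 (hg.monotone _ _ _ (by omega) (by omega) one_pos))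
  have cost_p := (shiftCost_comm g p q).trans_le (hg.shiftCost_le q p)
  have increment := hg.increment_mono two_pos two_pos (Nat.le_add_right 2 q) p
  rw [comm] at slope_q cost_p increment
  have mono_p := hg.monotone 2 (2 + p) 1 two_pos (Nat.le_add_right 2 p) one_pos
  simp only [interaction, hubWeight]
  push_cast
  linear_combination hg.le_add_shiftCost p q + cost_p + slope_p + slope_q + gain_q +
    2 * increment + mono_p

end IsDiscreteGoodEscalating

/-! ### Degrees within a set of vertices -/

section Graphs

open Classical

variable {V : Type*} {G : SimpleGraph V} {S T : Finset V} {v : V}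

/-- The number of neighbours of `v` in `S`; the vertex `v` itself may or may not belong to `S`. -/
noncomputable def degreeIn (G : SimpleGraph V) (S : Finset V) (v : V) : ℕ :=
  (S.filter (G.Adj v)).card

/-- The sum of the degrees of the subgraph induced by `S`, that is, twice its number of edges. -/
noncomputable def innerDegreeSum (G : SimpleGraph V) (S : Finset V) : ℕ :=
  ∑ v ∈ S, degreeIn G S v

theorem degreeIn_mono (G : SimpleGraph V) (h : S ⊆ T) (v : V) :
    degreeIn G S v ≤ degreeIn G T v :=
  Finset.card_le_card (Finset.filter_subset_filter _ h)

theorem degreeIn_union (G : SimpleGraph V) (h : Disjoint S T) (v : V) :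
    degreeIn G (S ∪ T) v = degreeIn G S v + degreeIn G T v := by
  rw [degreeIn, Finset.filter_union,
    Finset.card_union_of_disjoint (Finset.disjoint_filter_filter h), degreeIn, degreeIn]

theorem degreeIn_lt_card (G : SimpleGraph V) (hv : v ∈ S) : degreeIn G S v < S.card :=
  Finset.card_lt_card (Finset.filter_ssubset.2 ⟨v, hv, G.irrefl⟩)

theorem degreeIn_add_one_eq_card (hv : v ∈ S) (hS : ∀ u ∈ S, u ≠ v → G.Adj v u) :
    degreeIn G S v + 1 = S.card := by
  have filter_eq : S.filter (G.Adj v) = S.erase v := by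
    ext u
    simp only [Finset.mem_filter, Finset.mem_erase]
    exact ⟨fun h => ⟨h.2.ne', h.1⟩, fun h => ⟨h.2, hS u h.2 h.1⟩⟩
  rw [degreeIn, filter_eq, Finset.card_erase_add_one hv]

theorem sum_adj_comm {M : Type*} [AddCommMonoid M] (G : SimpleGraph V) (S T : Finset V)
    (F : V → V → M) :
    ∑ u ∈ S, ∑ v ∈ T.filter (G.Adj u), F u v = ∑ v ∈ T, ∑ u ∈ S.filter (G.Adj v), F u v :=
  Finset.sum_comm' fun u v => by simp only [Finset.mem_filter, G.adj_comm u v]; tauto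

theorem sum_degreeIn_comm (G : SimpleGraph V) (S T : Finset V) :
    ∑ u ∈ S, degreeIn G T u = ∑ v ∈ T, degreeIn G S v := by
  simp only [degreeIn, Finset.card_eq_sum_ones]
  exact sum_adj_comm G S T fun _ _ => 1

theorem sum_adj_insert {M : Type*} [AddCommMonoid M] (G : SimpleGraph V) (hv : v ∉ S)
    (F : V → V → M) (hF : ∀ u w, F u w = F w u) :
    ∑ u ∈ insert v S, ∑ w ∈ (insert v S).filter (G.Adj u), F u w =
      ∑ u ∈ S, ∑ w ∈ S.filter (G.Adj u), F u w + 2 • ∑ u ∈ S.filter (G.Adj v), F u v := by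
  have inner (u : V) : ∑ w ∈ (insert v S).filter (G.Adj u), F u w =
      (if G.Adj u v then F u v else 0) + ∑ w ∈ S.filter (G.Adj u), F u w := by
    rw [Finset.filter_insert]
    split_ifs
    · rw [Finset.sum_insert fun h => hv (Finset.mem_filter.1 h).1]
    · rw [zero_add]
  simp only [inner, Finset.sum_insert hv, Finset.sum_add_distrib, G.irrefl, if_false, zero_add]
  simp only [G.adj_comm _ v, ← Finset.sum_filter, hF v, two_nsmul]
  abel

theorem innerDegreeSum_insert (G : SimpleGraph V) (hv : v ∉ S) :
    innerDegreeSum G (insert v S) = innerDegreeSum G S + 2 * degreeIn G S v := by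
  simp only [innerDegreeSum, degreeIn, Finset.card_eq_sum_ones]
  exact sum_adj_insert G hv (fun _ _ => 1) fun _ _ => rfl

theorem innerDegreeSum_union (G : SimpleGraph V) (h : Disjoint S T) :
    innerDegreeSum G (S ∪ T) =
      innerDegreeSum G S + 2 * ∑ v ∈ T, degreeIn G S v + innerDegreeSum G T := by
  simp only [innerDegreeSum, Finset.sum_union h, degreeIn_union G h, Finset.sum_add_distrib,
    sum_degreeIn_comm G S T]
  ring

theorem exists_adj_mem_of_ne_univ [Fintype V] (hG : G.Connected) (hS : S.Nonempty)
    (hSu : S ≠ Finset.univ) : ∃ v ∉ S, ∃ u ∈ S, G.Adj v u := by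
  obtain ⟨a, ha⟩ := hS
  obtain ⟨b, hb⟩ : ∃ b, b ∉ S := by
    simpa only [ne_eq, Finset.eq_univ_iff_forall, not_forall] using hSu
  obtain ⟨walk⟩ := hG.preconnected a b
  obtain ⟨d, -, hfst, hsnd⟩ := walk.exists_boundary_dart (S : Set V) ha hb
  exact ⟨d.snd, hsnd, d.fst, hfst, d.adj.symm⟩

/-- The vertices that have at least two neighbours within `S`. If `S` induces a connected graph on
at least two vertices, then these are the vertices that are not leaves of that graph. -/
noncomputable def core (G : SimpleGraph V) (S : Finset V) : Finset V :=
  S.filter (2 ≤ degreeIn G S ·)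

theorem core_subset (G : SimpleGraph V) (S : Finset V) : core G S ⊆ S :=
  Finset.filter_subset _ _

theorem two_le_degreeIn_of_mem_core (hv : v ∈ core G S) : 2 ≤ degreeIn G S v :=
  (Finset.mem_filter.1 hv).2

theorem degreeIn_eq_one_of_mem_sdiff_core (hS : ∀ v ∈ S, 1 ≤ degreeIn G S v)
    (hv : v ∈ S \ core G S) : degreeIn G S v = 1 := by
  rw [Finset.mem_sdiff, core, Finset.mem_filter, not_and, not_le] at hv
  have := hS v hv.1
  have := hv.2 hv.1
  omega

theorem sum_degreeIn_core (hS : ∀ v ∈ S, 1 ≤ degreeIn G S v) :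
    ∑ v ∈ core G S, degreeIn G S v + S.card = innerDegreeSum G S + (core G S).card := by
  have leaves : ∑ v ∈ S \ core G S, degreeIn G S v = (S \ core G S).card := by
    rw [Finset.card_eq_sum_ones]
    exact Finset.sum_congr rfl fun v hv => degreeIn_eq_one_of_mem_sdiff_core hS hv
  rw [innerDegreeSum, ← Finset.sum_sdiff (core_subset G S), leaves,
    ← Finset.card_sdiff_add_card_eq_card (core_subset G S)]
  ring

theorem innerDegreeSum_le_innerDegreeSum_core (hS : ∀ v ∈ S, 1 ≤ degreeIn G S v) :
    innerDegreeSum G S + 2 * (core G S).card ≤ innerDegreeSum G (core G S) + 2 * S.card := by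
  have hdisj : Disjoint (core G S) (S \ core G S) := Finset.disjoint_sdiff
  have hunion : core G S ∪ S \ core G S = S := Finset.union_sdiff_of_subset (core_subset G S)
  have leaves : ∑ v ∈ S \ core G S, degreeIn G (core G S) v +
      innerDegreeSum G (S \ core G S) = (S \ core G S).card := by
    rw [innerDegreeSum, ← Finset.sum_add_distrib, Finset.card_eq_sum_ones]
    refine Finset.sum_congr rfl fun v hv => ?_
    rw [← degreeIn_union G hdisj, hunion, degreeIn_eq_one_of_mem_sdiff_core hS hv]
  have split := innerDegreeSum_union G hdisj
  rw [hunion] at split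
  have := Finset.card_sdiff_add_card_eq_card (core_subset G S)
  omega

theorem innerDegreeSum_le_card_mul (G : SimpleGraph V) (S : Finset V) :
    innerDegreeSum G S ≤ S.card * (S.card - 1) :=
  Finset.sum_le_card_nsmul _ _ _ fun _ hv => Nat.le_sub_one_of_lt (degreeIn_lt_card G hv)

theorem exists_pair_three_le_degreeIn (hcard : S.card = 4) (hsum : innerDegreeSum G S = 10) :
    ∃ x ∈ S, ∃ y ∈ S, x ≠ y ∧ 3 ≤ degreeIn G S x ∧ 3 ≤ degreeIn G S y := by
  have one_lt : 1 < (S.filter (3 ≤ degreeIn G S ·)).card := by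
    have : innerDegreeSum G S ≤ ∑ u ∈ S, (2 + if 3 ≤ degreeIn G S u then 1 else 0) :=
      Finset.sum_le_sum fun u hu => by
        have := degreeIn_lt_card G hu
        split_ifs <;> omega
    rw [Finset.sum_add_distrib, Finset.sum_const, smul_eq_mul, ← Finset.card_filter] at this
    omega
  obtain ⟨x, hx, y, hy, hxy⟩ := Finset.one_lt_card.1 one_lt
  rw [Finset.mem_filter] at hx hy
  exact ⟨x, hx.1, y, hy.1, hxy, hx.2, hy.2⟩

variable [Fintype V]

theorem degreeIn_univ (G : SimpleGraph V) (v : V) : degreeIn G Finset.univ v = G.degree v := by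
  rw [degreeIn, ← SimpleGraph.neighborFinset_eq_filter, SimpleGraph.card_neighborFinset_eq_degree]

theorem degreeIn_le_degree (G : SimpleGraph V) (S : Finset V) (v : V) :
    degreeIn G S v ≤ G.degree v :=
  (degreeIn_mono G S.subset_univ v).trans_eq (degreeIn_univ G v)

theorem degreeIn_eq_degree (hS : ∀ u, G.Adj v u → u ∈ S) : degreeIn G S v = G.degree v := by
  rw [← degreeIn_univ, degreeIn, degreeIn]
  congr 1
  ext u
  simpa only [Finset.mem_filter, Finset.mem_univ, true_and, and_iff_right_iff_imp] using hS u

theorem innerDegreeSum_univ (G : SimpleGraph V) :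
    innerDegreeSum G Finset.univ = 2 * G.edgeFinset.card := by
  simp only [innerDegreeSum, degreeIn_univ, SimpleGraph.sum_degrees_eq_twice_card_edges]

theorem innerDegreeSum_le (hG : G.Connected) (hS : S.Nonempty) :
    innerDegreeSum G S + 2 * Fintype.card V ≤ 2 * G.edgeFinset.card + 2 * S.card := by
  induction hm : Fintype.card V - S.card generalizing S with
  | zero =>
    have hSu : S = Finset.univ :=
      S.card_eq_iff_eq_univ.1 (S.card_le_univ.antisymm (Nat.sub_eq_zero_iff_le.1 hm))
    rw [hSu, innerDegreeSum_univ, Finset.card_univ]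
  | succ m ih =>
    have hSu : S ≠ Finset.univ := by
      rintro rfl
      simp at hm
    obtain ⟨v, hv, u, hu, hvu⟩ := exists_adj_mem_of_ne_univ hG hS hSu
    have insert_le := ih (S := insert v S) (Finset.insert_nonempty _ _)
      (by rw [Finset.card_insert_of_notMem hv]; omega)
    rw [innerDegreeSum_insert G hv, Finset.card_insert_of_notMem hv] at insert_le
    have : 0 < degreeIn G S v := Finset.card_pos.2 ⟨u, Finset.mem_filter.2 ⟨hu, hvu⟩⟩
    omega

theorem IsCyclicGraph.innerDegreeSum_le {c : ℕ} (hG : IsCyclicGraph c G) (hS : S.Nonempty) :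
    innerDegreeSum G S + 2 ≤ 2 * (S.card + c) := by
  have := _root_.innerDegreeSum_le hG.1 hS
  have := hG.2
  omega

theorem IsCyclicGraph.exists_degreeIn_le {c t : ℕ} (hG : IsCyclicGraph c G)
    (hc : 2 * c < t * (t + 1)) (hS : S.Nonempty) : ∃ v ∈ S, degreeIn G S v ≤ t := by
  by_contra! h
  have lower : S.card * (t + 1) ≤ innerDegreeSum G S := by
    rw [← smul_eq_mul]
    exact Finset.card_nsmul_le_sum _ _ _ h
  have upper := hG.innerDegreeSum_le hS
  obtain ⟨v, hv⟩ := hS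
  have card_lower : t + 2 ≤ S.card := lt_of_le_of_lt (h v hv) (degreeIn_lt_card G hv)
  have ht : 1 ≤ t := Nat.one_le_iff_ne_zero.2 (by rintro rfl; simp at hc)
  nlinarith

/-! ### Merging vertices into a hub -/

/-- The sum of the interactions of the ordered pairs of adjacent vertices in `S`, so that each edge
is counted twice. -/
noncomputable def pairInteraction (g : ℕ → ℕ → ℝ) (G : SimpleGraph V) (S : Finset V) : ℝ :=
  ∑ u ∈ S, ∑ v ∈ S.filter (G.Adj u), interaction g (G.degree u) (G.degree v)

/-- The part of the connectivity function that is due to the vertices of `S`, when `a v` neighbours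
of `v` are considered as nonpendant. Vertices of degree `2` contribute nothing to it. -/
noncomputable def mergeEnergy (g : ℕ → ℕ → ℝ) (G : SimpleGraph V) (a : V → ℝ) (S : Finset V) : ℝ :=
  ∑ v ∈ S, (hubWeight g (G.degree v) (a v) - 2 * g 2 2) + pairInteraction g G S / 2

/-- The degree of the hub obtained by moving all but two neighbours of each vertex of `S` to one
common vertex. -/
noncomputable def hubDegree (G : SimpleGraph V) (S : Finset V) : ℕ :=
  2 + ∑ v ∈ S, (G.degree v - 2)

/-- Replacing the vertices of `S` by a single hub with `α` nonpendant neighbours does not decrease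
the energy. -/
def MergesInto (g : ℕ → ℕ → ℝ) (G : SimpleGraph V) (a : V → ℝ) (S : Finset V) (α : ℝ) : Prop :=
  mergeEnergy g G a S ≤ hubWeight g (hubDegree G S) α - 2 * g 2 2

theorem hubDegree_insert (hv : v ∉ S) :
    hubDegree G (insert v S) = hubDegree G S + (G.degree v - 2) := by
  rw [hubDegree, hubDegree, Finset.sum_insert hv]; omega

theorem degree_le_hubDegree (hv : v ∈ S) : G.degree v ≤ hubDegree G S := by
  have := Finset.single_le_sum (f := fun u => G.degree u - 2) (fun _ _ => Nat.zero_le _) hv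
  rw [hubDegree]; omega

theorem two_le_hubDegree (G : SimpleGraph V) (S : Finset V) : 2 ≤ hubDegree G S :=
  Nat.le_add_right _ _

variable {g : ℕ → ℕ → ℝ} {a : V → ℝ} {α β : ℝ}

theorem mergeEnergy_insert_le (hg : IsDiscreteEscalating g) (hS : ∀ u ∈ S, 2 ≤ G.degree u)
    (hv : v ∉ S) (hdv : 2 ≤ G.degree v) :
    mergeEnergy g G a (insert v S) ≤ mergeEnergy g G a S +
      (hubWeight g (G.degree v) (a v) - 2 * g 2 2) +
      degreeIn G S v * interaction g (hubDegree G S) (G.degree v) := by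
  have interaction_le : ∑ u ∈ S.filter (G.Adj v), interaction g (G.degree u) (G.degree v) ≤
      degreeIn G S v * interaction g (hubDegree G S) (G.degree v) := by
    rw [← nsmul_eq_mul]
    refine Finset.sum_le_card_nsmul _ _ _ fun u hu => ?_
    have hu := (Finset.mem_filter.1 hu).1
    exact hg.interaction_mono_left (two_pos.trans_le (hS u hu)) (degree_le_hubDegree hu) hdv
  have pairInteraction_insert : pairInteraction g G (insert v S) = _ := sum_adj_insert G hv
    (fun u w => interaction g (G.degree u) (G.degree w)) fun u w => hg.interaction_comm _ _
  rw [mergeEnergy, mergeEnergy, pairInteraction_insert, Finset.sum_insert hv, pairInteraction,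
    nsmul_eq_mul]
  push_cast
  linarith

namespace MergesInto

theorem empty (g : ℕ → ℕ → ℝ) (G : SimpleGraph V) (a : V → ℝ) (α : ℝ) :
    MergesInto g G a ∅ α := by
  simp [MergesInto, mergeEnergy, pairInteraction, hubDegree, hubWeight_two]

theorem singleton (g : ℕ → ℕ → ℝ) (a : V → ℝ) (hv : 2 ≤ G.degree v) :
    MergesInto g G a {v} (a v) := by
  simp [MergesInto, mergeEnergy, pairInteraction, hubDegree, Finset.filter_singleton,
    Nat.add_sub_cancel' hv]

theorem mono (hg : IsDiscreteEscalating g) (h : MergesInto g G a S α) (hαβ : α ≤ β) :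
    MergesInto g G a S β :=
  h.trans (sub_le_sub_right (hg.hubWeight_mono (two_le_hubDegree G S) hαβ) _)

theorem insert_of_le (hg : IsDiscreteEscalating g) (h : MergesInto g G a S α)
    (hS : ∀ u ∈ S, 2 ≤ G.degree u) (hv : v ∉ S) (hdv : 2 ≤ G.degree v) {e : ℕ}
    (he : degreeIn G S v ≤ e)
    (merge : e * interaction g (hubDegree G S) (G.degree v) + hubWeight g (hubDegree G S) α +
      hubWeight g (G.degree v) (a v) ≤ hubWeight g (hubDegree G (insert v S)) β + 2 * g 2 2) :
    MergesInto g G a (insert v S) β := by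
  have energy_le := mergeEnergy_insert_le (a := a) hg hS hv hdv
  have count_le := mul_le_mul_of_nonneg_right (Nat.cast_le (α := ℝ).2 he)
    (hg.interaction_nonneg (two_le_hubDegree G S) hdv)
  unfold MergesInto at h ⊢
  linarith

theorem insert_of_degreeIn_le (hg : IsDiscreteGoodEscalating g) {t : ℕ} (ht : t = 1 ∨ t = 2)
    (h : MergesInto g G a S α) (hS : ∀ u ∈ S, 2 ≤ G.degree u) (hv : v ∉ S)
    (hdv : 2 ≤ G.degree v) (he : degreeIn G S v ≤ t) (hα : t ≤ α) (hav : t ≤ a v) :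
    MergesInto g G a (insert v S) (α + (a v - t)) := by
  refine h.insert_of_le hg.toIsDiscreteEscalating hS hv hdv he ?_
  obtain ⟨q, hq⟩ := Nat.exists_eq_add_of_le hdv
  rw [hubDegree_insert hv, hubDegree, hq, Nat.add_sub_cancel_left, ← add_sub_assoc]
  exact hg.hubWeight_merge ht _ q hα hav

theorem insert_of_three_le (hg : IsDiscreteGoodEscalating g) (h : MergesInto g G a S α)
    (hS : ∀ u ∈ S, 2 ≤ G.degree u) (hv : v ∉ S) (hdv : 3 ≤ G.degree v)
    (he : degreeIn G S v ≤ 1) (hα : 3 ≤ α) (hav : 3 ≤ a v) :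
    MergesInto g G a (insert v S) (α + a v - 3) := by
  have hdv' : 2 ≤ G.degree v := le_of_lt hdv
  refine h.insert_of_le hg.toIsDiscreteEscalating hS hv hdv' he ?_
  obtain ⟨q, hq⟩ := Nat.exists_eq_add_of_le hdv'
  rw [hubDegree_insert hv, hubDegree, hq, Nat.add_sub_cancel_left, Nat.cast_one, one_mul]
  exact hg.hubWeight_merge_of_three_le _ (by omega) hα hav

theorem union (hg : IsDiscreteGoodEscalating g) {t : ℕ} (ht : t = 1 ∨ t = 2)
    (h : MergesInto g G a S α) (hα : t ≤ α) (hST : Disjoint S T)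
    (hd : ∀ u ∈ S ∪ T, 2 ≤ G.degree u) (ha : ∀ u ∈ T, t ≤ a u)
    (hdeg : ∀ T' ⊆ T, T'.Nonempty → ∃ u ∈ T', degreeIn G (S ∪ T') u ≤ t) :
    MergesInto g G a (S ∪ T) (α + ∑ u ∈ T, (a u - t)) := by
  induction hm : T.card generalizing T with
  | zero => simpa [Finset.card_eq_zero.1 hm] using h
  | succ m ih =>
    obtain ⟨v, hv, hdv⟩ := hdeg T subset_rfl (Finset.card_pos.1 (by omega))
    have sub : T.erase v ⊆ T := T.erase_subset v
    have merge_erase := ih (hST.mono_right sub)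
      (fun u hu => hd u (Finset.union_subset_union_right sub hu)) (fun u hu => ha u (sub hu))
      (fun T' hT' => hdeg T' (hT'.trans sub)) (by rw [Finset.card_erase_of_mem hv, hm]; rfl)
    have sum_nonneg : 0 ≤ ∑ u ∈ T.erase v, (a u - t) :=
      Finset.sum_nonneg fun u hu => sub_nonneg.2 (ha u (sub hu))
    have hvS : v ∉ S ∪ T.erase v := by
      simp [Finset.disjoint_right.1 hST hv]
    have merge := merge_erase.insert_of_degreeIn_le hg ht
      (fun u hu => hd u (Finset.union_subset_union_right sub hu)) hvS
      (hd v (Finset.mem_union_right S hv))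
      ((degreeIn_mono G (Finset.union_subset_union_right sub) v).trans hdv)
      (hα.trans (le_add_of_nonneg_right sum_nonneg)) (ha v hv)
    rwa [← Finset.union_insert, Finset.insert_erase hv, add_assoc,
      Finset.sum_erase_add _ _ hv] at merge

end MergesInto

/-! ### Pendant and nonpendant vertices -/

/-- The vertices of degree at least `2`; in a connected graph on at least three vertices these are
the vertices that are not pendant. -/
noncomputable def nonpendants (G : SimpleGraph V) : Finset V :=
  Finset.univ.filter fun v => 2 ≤ G.degree v

/-- The vertices of degree `1`, as a finite set. -/
noncomputable def pendants (G : SimpleGraph V) : Finset V :=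
  Finset.univ.filter fun v => G.degree v = 1

theorem card_pendants (G : SimpleGraph V) : (pendants G).card = pendantCount G := rfl

theorem two_le_degree_of_mem_nonpendants (hv : v ∈ nonpendants G) : 2 ≤ G.degree v :=
  (Finset.mem_filter.1 hv).2

theorem degree_of_mem_pendants (hv : v ∈ pendants G) : G.degree v = 1 :=
  (Finset.mem_filter.1 hv).2

theorem disjoint_nonpendants_pendants (G : SimpleGraph V) :
    Disjoint (nonpendants G) (pendants G) :=
  Finset.disjoint_filter.2 fun _ _ _ _ => by omega

theorem degree_pos_of_connected (hG : G.Connected) (h3 : 3 ≤ Fintype.card V) (v : V) :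
    0 < G.degree v :=
  have := Fintype.one_lt_card_iff_nontrivial.1 (one_lt_two.trans_le ((Nat.le_succ 2).trans h3))
  hG.preconnected.degree_pos_of_nontrivial v

theorem nonpendants_union_pendants (hG : G.Connected) (h3 : 3 ≤ Fintype.card V) :
    nonpendants G ∪ pendants G = Finset.univ := by
  ext v
  have := degree_pos_of_connected hG h3 v
  simp only [nonpendants, pendants, Finset.mem_union, Finset.mem_filter, Finset.mem_univ, true_and,
    iff_true]
  omega

theorem sum_nonpendants_add_sum_pendants {M : Type*} [AddCommMonoid M] (hG : G.Connected)
    (h3 : 3 ≤ Fintype.card V) (F : V → M) :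
    ∑ v ∈ nonpendants G, F v + ∑ v ∈ pendants G, F v = ∑ v, F v := by
  rw [← nonpendants_union_pendants hG h3, Finset.sum_union (disjoint_nonpendants_pendants G)]

theorem eq_of_adj_of_degree_eq_one {u w : V} (hv : G.degree v = 1) (hu : G.Adj v u)
    (hw : G.Adj v w) : u = w :=
  (SimpleGraph.degree_eq_one_iff_existsUnique_adj.1 hv).unique hu hw

theorem not_adj_of_mem_pendants (hG : G.Connected) (h3 : 3 ≤ Fintype.card V) {u : V}
    (hu : u ∈ pendants G) (hv : v ∈ pendants G) : ¬ G.Adj u v := by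
  intro huv
  have pair_ne_univ : ({u, v} : Finset V) ≠ Finset.univ := fun h => by
    have := Finset.card_le_two (a := u) (b := v)
    rw [h, Finset.card_univ] at this
    omega
  obtain ⟨w, hw, x, hx, hwx⟩ :=
    exists_adj_mem_of_ne_univ hG (Finset.insert_nonempty u {v}) pair_ne_univ
  simp only [Finset.mem_insert, Finset.mem_singleton, not_or] at hw hx
  rcases hx with rfl | rfl
  · exact hw.2 (eq_of_adj_of_degree_eq_one (degree_of_mem_pendants hu) hwx.symm huv)
  · exact hw.1 (eq_of_adj_of_degree_eq_one (degree_of_mem_pendants hv) hwx.symm huv.symm)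

theorem filter_adj_pendants_eq_empty (hG : G.Connected) (h3 : 3 ≤ Fintype.card V)
    (hv : v ∈ pendants G) : (pendants G).filter (G.Adj v) = ∅ :=
  Finset.filter_eq_empty_iff.2 fun _ hu => not_adj_of_mem_pendants hG h3 hv hu

theorem degreeIn_nonpendants_add_degreeIn_pendants (hG : G.Connected)
    (h3 : 3 ≤ Fintype.card V) (v : V) :
    degreeIn G (nonpendants G) v + degreeIn G (pendants G) v = G.degree v := by
  rw [← degreeIn_union G (disjoint_nonpendants_pendants G), nonpendants_union_pendants hG h3,
    degreeIn_univ]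

theorem card_nonpendants (hG : G.Connected) (h3 : 3 ≤ Fintype.card V) :
    (nonpendants G).card + pendantCount G = Fintype.card V := by
  rw [← Finset.card_univ, ← nonpendants_union_pendants hG h3,
    Finset.card_union_of_disjoint (disjoint_nonpendants_pendants G), card_pendants]

theorem sum_degree_nonpendants (hG : G.Connected) (h3 : 3 ≤ Fintype.card V) :
    ∑ v ∈ nonpendants G, G.degree v + pendantCount G = 2 * G.edgeFinset.card := by
  rw [← G.sum_degrees_eq_twice_card_edges, ← sum_nonpendants_add_sum_pendants hG h3,
    Finset.sum_congr rfl fun v (hv : v ∈ pendants G) => degree_of_mem_pendants hv,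
    Finset.sum_const, smul_eq_mul, mul_one, card_pendants]

theorem sum_degreeIn_pendants (hG : G.Connected) (h3 : 3 ≤ Fintype.card V) :
    ∑ v ∈ nonpendants G, degreeIn G (pendants G) v = pendantCount G := by
  have one (v : V) (hv : v ∈ pendants G) : degreeIn G (nonpendants G) v = 1 := by
    have := degreeIn_nonpendants_add_degreeIn_pendants hG h3 v
    rwa [degreeIn.eq_def G (pendants G), filter_adj_pendants_eq_empty hG h3 hv,
      Finset.card_empty, add_zero, degree_of_mem_pendants hv] at this
  rw [sum_degreeIn_comm, Finset.sum_congr rfl one, Finset.sum_const, smul_eq_mul, mul_one,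
    card_pendants]

theorem innerDegreeSum_nonpendants (hG : G.Connected) (h3 : 3 ≤ Fintype.card V) :
    innerDegreeSum G (nonpendants G) + 2 * pendantCount G = 2 * G.edgeFinset.card := by
  rw [← sum_degree_nonpendants hG h3, two_mul, ← add_assoc, innerDegreeSum]
  nth_rw 1 [← sum_degreeIn_pendants hG h3]
  simp only [← Finset.sum_add_distrib, degreeIn_nonpendants_add_degreeIn_pendants hG h3]

theorem hubDegree_nonpendants {c : ℕ} (hG : IsCyclicGraph c G) (h3 : 3 ≤ Fintype.card V) :
    hubDegree G (nonpendants G) = pendantCount G + 2 * c := by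
  have degree_sum := sum_degree_nonpendants hG.1 h3
  have card_sum := card_nonpendants hG.1 h3
  have card_edges := hG.2
  have sum_sub_two : ∑ v ∈ nonpendants G, (G.degree v - 2) + (nonpendants G).card * 2 =
      ∑ v ∈ nonpendants G, G.degree v := by
    rw [← smul_eq_mul, ← Finset.sum_const, ← Finset.sum_add_distrib]
    exact Finset.sum_congr rfl fun v hv =>
      Nat.sub_add_cancel (two_le_degree_of_mem_nonpendants hv)
  rw [hubDegree]
  omega

theorem sum_adj_eq_two_nsmul_sum_edgeFinset {M : Type*} [AddCommMonoid M] (G : SimpleGraph V)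
    (F : Sym2 V → M) :
    ∑ u, ∑ v ∈ Finset.univ.filter (G.Adj u), F s(u, v) = 2 • ∑ e ∈ G.edgeFinset, F e := by
  calc ∑ u, ∑ v ∈ Finset.univ.filter (G.Adj u), F s(u, v)
      = ∑ p : V × V with G.Adj p.1 p.2, F s(p.1, p.2) := by
        simp only [Finset.sum_filter]
        exact (Fintype.sum_prod_type' fun u v => if G.Adj u v then F s(u, v) else 0).symm
    _ = ∑ d : G.Dart, F d.edge :=
        Finset.sum_bij' (fun p hp => ⟨p, (Finset.mem_filter.1 hp).2⟩) (fun d _ => d.toProd)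
          (by simp) (fun d _ => by simp [d.adj]) (by simp) (by simp)
          fun _ _ => rfl
    _ = ∑ e ∈ G.edgeFinset, ∑ d : G.Dart with d.edge = e, F d.edge :=
        (Finset.sum_fiberwise_of_maps_to
          (fun d _ => SimpleGraph.mem_edgeFinset.2 d.edge_mem) _).symm
    _ = ∑ e ∈ G.edgeFinset, 2 • F e := by
        refine Finset.sum_congr rfl fun e he => ?_
        rw [Finset.sum_congr rfl fun d hd => by rw [(Finset.mem_filter.1 hd).2], Finset.sum_const,
          G.dart_edge_fiber_card e (SimpleGraph.mem_edgeFinset.1 he)]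
    _ = 2 • ∑ e ∈ G.edgeFinset, F e := (Finset.smul_sum ..).symm

theorem pairInteraction_univ (hg : IsDiscreteEscalating g) (hG : G.Connected)
    (h3 : 3 ≤ Fintype.card V) :
    pairInteraction g G Finset.univ = pairInteraction g G (nonpendants G) +
      2 * ∑ u ∈ nonpendants G, degreeIn G (pendants G) u * interaction g (G.degree u) 1 := by
  have split (u : V) : ∑ v ∈ Finset.univ.filter (G.Adj u), interaction g (G.degree u) (G.degree v) =
      ∑ v ∈ (nonpendants G).filter (G.Adj u), interaction g (G.degree u) (G.degree v) +
      ∑ v ∈ (pendants G).filter (G.Adj u), interaction g (G.degree u) (G.degree v) := by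
    simp only [Finset.sum_filter, sum_nonpendants_add_sum_pendants hG h3]
  have pendant_neighbors (u : V) :
      ∑ v ∈ (pendants G).filter (G.Adj u), interaction g (G.degree u) (G.degree v) =
        degreeIn G (pendants G) u * interaction g (G.degree u) 1 := by
    rw [degreeIn, ← nsmul_eq_mul, ← Finset.sum_const]
    refine Finset.sum_congr rfl fun v hv => ?_
    rw [degree_of_mem_pendants (Finset.mem_filter.1 hv).1]
  have pendant_pendant : ∑ u ∈ pendants G, ∑ v ∈ (pendants G).filter (G.Adj u),
      interaction g (G.degree u) (G.degree v) = 0 :=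
    Finset.sum_eq_zero fun u hu => by
      rw [filter_adj_pendants_eq_empty hG h3 hu, Finset.sum_empty]
  have pendant_nonpendant : ∑ u ∈ pendants G, ∑ v ∈ (nonpendants G).filter (G.Adj u),
      interaction g (G.degree u) (G.degree v) = ∑ u ∈ nonpendants G,
        ∑ v ∈ (pendants G).filter (G.Adj u), interaction g (G.degree u) (G.degree v) := by
    rw [sum_adj_comm]
    simp only [hg.interaction_comm]
  rw [pairInteraction, ← sum_nonpendants_add_sum_pendants hG h3]
  simp only [split, Finset.sum_add_distrib]
  rw [pendant_pendant, pendant_nonpendant, pairInteraction]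
  simp only [pendant_neighbors]
  ring

theorem two_mul_connectivityFunction (f : ℝ → ℝ → ℝ) (hsymm : ∀ x y, f x y = f y x)
    (G : SimpleGraph V) :
    2 * connectivityFunction f hsymm G =
      2 * ∑ u, (G.degree u : ℝ) * f (G.degree u) 2 - 2 * G.edgeFinset.card * f 2 2 +
        pairInteraction (natRestriction f) G Finset.univ := by
  have expand (u v : V) : f (G.degree u) (G.degree v) = f (G.degree u) 2 + f (G.degree v) 2 -
      f 2 2 + interaction (natRestriction f) (G.degree u) (G.degree v) := by
    simp only [interaction, natRestriction, Nat.cast_ofNat]; ring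
  have card_neighbors (u : V) : (Finset.univ.filter (G.Adj u)).card = G.degree u :=
    degreeIn_univ G u
  have sum_edges := sum_adj_eq_two_nsmul_sum_edgeFinset G
    (Sym2.lift ⟨fun u v : V => f (G.degree u : ℝ) (G.degree v : ℝ), fun _ _ => hsymm _ _⟩)
  rw [nsmul_eq_mul, Nat.cast_ofNat] at sum_edges
  rw [connectivityFunction, ← sum_edges]
  simp only [Sym2.lift_mk, expand, Finset.sum_add_distrib, Finset.sum_sub_distrib]
  rw [sum_adj_comm G Finset.univ Finset.univ fun _ v => f (G.degree v) 2]
  simp only [Finset.sum_const, card_neighbors, nsmul_eq_mul]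
  rw [← Finset.sum_mul, ← Nat.cast_sum, G.sum_degrees_eq_twice_card_edges, pairInteraction]
  push_cast
  ring

theorem sum_hubWeight_nonpendants (hg : IsDiscreteEscalating g) (hG : G.Connected)
    (h3 : 3 ≤ Fintype.card V) :
    ∑ v ∈ nonpendants G, hubWeight g (G.degree v) (degreeIn G (nonpendants G) v) =
      ∑ v ∈ nonpendants G, (G.degree v : ℝ) * g (G.degree v) 2 +
      ∑ v ∈ nonpendants G, degreeIn G (pendants G) v * interaction g (G.degree v) 1 := by
  rw [← Finset.sum_add_distrib]
  refine Finset.sum_congr rfl fun v _ => ?_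
  have degree_split : (degreeIn G (nonpendants G) v + degreeIn G (pendants G) v : ℝ) =
      G.degree v := by
    exact_mod_cast degreeIn_nonpendants_add_degreeIn_pendants hG h3 v
  simp only [hubWeight, interaction, hg.symm 1 2, ← degree_split]
  ring

theorem connectivityFunction_eq_mergeEnergy {f : ℝ → ℝ → ℝ} (hsymm : ∀ x y, f x y = f y x)
    (hf : IsDiscreteEscalating (natRestriction f)) (hG : G.Connected)
    (h3 : 3 ≤ Fintype.card V) :
    connectivityFunction f hsymm G =
      mergeEnergy (natRestriction f) G (fun v => degreeIn G (nonpendants G) v) (nonpendants G) +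
        (2 * (nonpendants G).card - G.edgeFinset.card) * f 2 2 + pendantCount G * f 1 2 := by
  have expansion := two_mul_connectivityFunction f hsymm G
  have pendant_sum : ∑ u ∈ pendants G, (G.degree u : ℝ) * f (G.degree u) 2 =
      pendantCount G * f 1 2 := by
    rw [← card_pendants, ← nsmul_eq_mul, ← Finset.sum_const]
    refine Finset.sum_congr rfl fun u hu => ?_
    rw [degree_of_mem_pendants hu, Nat.cast_one, one_mul]
  rw [← sum_nonpendants_add_sum_pendants hG h3, pendant_sum, pairInteraction_univ hf hG h3]
    at expansion
  rw [mergeEnergy, Finset.sum_sub_distrib, sum_hubWeight_nonpendants hf hG h3, Finset.sum_const,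
    nsmul_eq_mul]
  simp only [natRestriction, Nat.cast_ofNat] at expansion ⊢
  linarith

/-! ### Merging the nonpendant vertices of a `c`-cyclic graph -/

theorem mergeEnergy_mono (hg : IsDiscreteEscalating g) {b : V → ℝ}
    (hS : ∀ v ∈ S, 2 ≤ G.degree v) (hab : ∀ v ∈ S, a v ≤ b v) :
    mergeEnergy g G a S ≤ mergeEnergy g G b S :=
  add_le_add_left (Finset.sum_le_sum fun v hv =>
    sub_le_sub_right (hg.hubWeight_mono (hS v hv) (hab v hv)) _) _

theorem IsCyclicGraph.mergesInto (hg : IsDiscreteGoodEscalating g) {c t : ℕ}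
    (ht : t = 1 ∨ t = 2) (hc : 2 * c < t * (t + 1)) (hG : IsCyclicGraph c G)
    (hS : ∀ u ∈ S, 2 ≤ G.degree u) (ha : ∀ u ∈ S, t ≤ a u) :
    MergesInto g G a S (t + ∑ u ∈ S, (a u - t)) := by
  rw [← Finset.empty_union S] at hS
  have := (MergesInto.empty g G a t).union hg ht le_rfl (Finset.disjoint_empty_left S) hS ha
    fun T _ hT => by simpa only [Finset.empty_union] using hG.exists_degreeIn_le hc hT
  rwa [Finset.empty_union] at this

theorem mergesInto_of_card_eq_four (hg : IsDiscreteGoodEscalating g) (hcard : S.card = 4)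
    (hsum : innerDegreeSum G S = 10) (hd : ∀ u ∈ S, 2 ≤ G.degree u)
    (ha : ∀ u ∈ S, degreeIn G S u ≤ a u) (ha2 : ∀ u ∈ S, 2 ≤ a u) :
    MergesInto g G a S (1 + ∑ u ∈ S, (a u - 2)) := by
  obtain ⟨x, hx, y, hy, hxy, hx3, hy3⟩ := exists_pair_three_le_degreeIn hcard hsum
  have hax : 3 ≤ a x := le_trans (by exact_mod_cast hx3) (ha x hx)
  have hay : 3 ≤ a y := le_trans (by exact_mod_cast hy3) (ha y hy)
  have pair_sub : {y, x} ⊆ S := Finset.insert_subset hy (Finset.singleton_subset_iff.2 hx)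
  have merge_pair : MergesInto g G a {y, x} (a x + a y - 3) :=
    (MergesInto.singleton g a (hd x hx)).insert_of_three_le hg (by simpa using hd x hx)
      (by simpa using hxy.symm) (hy3.trans (degreeIn_le_degree G S y))
      (Finset.card_filter_le _ _) hax hay
  have merge := merge_pair.union hg (Or.inr rfl)
    (by push_cast; linarith) (T := S \ {y, x})
    Finset.disjoint_sdiff (by rwa [Finset.union_sdiff_of_subset pair_sub])
    (fun u hu => ha2 u (Finset.sdiff_subset hu)) ?_
  · rw [Finset.union_sdiff_of_subset pair_sub] at merge
    convert merge using 1
    rw [← Finset.sum_sdiff pair_sub, Finset.sum_pair hxy.symm]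
    push_cast
    ring
  · intro T hT ⟨z, hz⟩
    by_contra! h
    have union_eq : {y, x} ∪ T = S :=
      Finset.eq_of_subset_of_card_le (Finset.union_subset pair_sub (hT.trans Finset.sdiff_subset))
        (by have := degreeIn_lt_card G (Finset.mem_union_right {y, x} hz); have := h z hz; omega)
    have : S.card • 3 ≤ innerDegreeSum G S :=
      Finset.card_nsmul_le_sum S (degreeIn G S) 3 fun u hu => by
        rw [← union_eq, Finset.mem_union, Finset.mem_insert, Finset.mem_singleton] at hu
        rcases hu with (rfl | rfl) | hu
        exacts [hy3, hx3, union_eq ▸ h u hu]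
    rw [smul_eq_mul] at this
    omega

theorem one_le_degreeIn_nonpendants (hG : G.Connected) (h3 : 3 ≤ Fintype.card V)
    (h2 : 2 ≤ (nonpendants G).card) (hv : v ∈ nonpendants G) :
    1 ≤ degreeIn G (nonpendants G) v := by
  have card_erase := Finset.card_erase_of_mem hv
  have erase_le := innerDegreeSum_le hG (Finset.card_pos.1 (by omega) :
    ((nonpendants G).erase v).Nonempty)
  have insert_eq := innerDegreeSum_insert G (Finset.notMem_erase v (nonpendants G))
  rw [Finset.insert_erase hv] at insert_eq
  have := innerDegreeSum_nonpendants hG h3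
  have := card_nonpendants hG h3
  have := degreeIn_mono G ((nonpendants G).erase_subset v) v
  omega

namespace IsCyclicGraph

variable {c : ℕ}

theorem innerDegreeSum_nonpendants_add_two (hG : IsCyclicGraph c G) (h3 : 3 ≤ Fintype.card V) :
    innerDegreeSum G (nonpendants G) + 2 = 2 * ((nonpendants G).card + c) := by
  have := innerDegreeSum_nonpendants hG.1 h3
  have := card_nonpendants hG.1 h3
  have := hG.2
  omega

theorem card_core_nonpendants (hG : IsCyclicGraph c G) (h3 : 3 ≤ Fintype.card V)
    (h2 : 2 ≤ (nonpendants G).card) (hc1 : 1 ≤ c) (hc2 : c ≤ 2) :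
    2 * c + 1 ≤ (core G (nonpendants G)).card ∨
      c = 2 ∧ (core G (nonpendants G)).card = 4 ∧
        innerDegreeSum G (core G (nonpendants G)) = 10 := by
  have pos (v : V) (hv : v ∈ nonpendants G) := one_le_degreeIn_nonpendants hG.1 h3 h2 hv
  have inner_eq := hG.innerDegreeSum_nonpendants_add_two h3
  have core_ne : (core G (nonpendants G)).Nonempty := Finset.nonempty_iff_ne_empty.2 fun h => by
    have := sum_degreeIn_core pos
    rw [h, Finset.sum_empty, Finset.card_empty] at this
    omega
  have card_pos := core_ne.card_pos
  have inner_core_le := hG.innerDegreeSum_le core_ne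
  have le_inner_core := innerDegreeSum_le_innerDegreeSum_core pos
  have upper := innerDegreeSum_le_card_mul G (core G (nonpendants G))
  by_contra! h
  generalize (core G (nonpendants G)).card = s at *
  have hs : s ≤ 4 := by omega
  interval_cases c <;> interval_cases s <;> omega

theorem mergesInto_core_nonpendants (hg : IsDiscreteGoodEscalating g) (hG : IsCyclicGraph c G)
    (h3 : 3 ≤ Fintype.card V) (h2 : 2 ≤ (nonpendants G).card) (hc1 : 1 ≤ c) (hc2 : c ≤ 2) :
    MergesInto g G (fun v => degreeIn G (nonpendants G) v) (core G (nonpendants G))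
      ((nonpendants G).card - 1) := by
  have hd : ∀ u ∈ core G (nonpendants G), 2 ≤ G.degree u := fun u hu =>
    two_le_degree_of_mem_nonpendants (core_subset _ _ hu)
  have two_le : ∀ u ∈ core G (nonpendants G), (2 : ℝ) ≤ degreeIn G (nonpendants G) u :=
    fun u hu => by exact_mod_cast two_le_degreeIn_of_mem_core hu
  have sum_core : ∑ u ∈ core G (nonpendants G), ((degreeIn G (nonpendants G) u : ℝ) - 2) =
      (nonpendants G).card + 2 * c - 2 - (core G (nonpendants G)).card := by
    have sum_degreeIn := sum_degreeIn_core fun v hv => one_le_degreeIn_nonpendants hG.1 h3 h2 hv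
    have inner_eq := hG.innerDegreeSum_nonpendants_add_two h3
    rify at sum_degreeIn inner_eq
    rw [Finset.sum_sub_distrib, Finset.sum_const, nsmul_eq_mul]
    linarith
  rcases hG.card_core_nonpendants h3 h2 hc1 hc2 with hcard | ⟨rfl, hcard, hsum⟩
  · refine (hG.mergesInto hg (Or.inr rfl) (by omega) hd two_le).mono hg.toIsDiscreteEscalating ?_
    rify at hcard
    rw [Nat.cast_ofNat, sum_core]
    linarith
  · convert mergesInto_of_card_eq_four hg hcard hsum hd
      (fun u _ => Nat.cast_le.2 (degreeIn_mono G (core_subset _ _) u)) two_le using 1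
    rw [sum_core, hcard]
    push_cast
    ring

theorem mergesInto_nonpendants_card_sub_one (hg : IsDiscreteGoodEscalating g)
    (hG : IsCyclicGraph c G) (h3 : 3 ≤ Fintype.card V) (hN : (nonpendants G).Nonempty)
    (hc : c ≤ 2) :
    MergesInto g G (fun v => degreeIn G (nonpendants G) v) (nonpendants G)
      ((nonpendants G).card - 1) := by
  have hd : ∀ u ∈ nonpendants G, 2 ≤ G.degree u := fun _ => two_le_degree_of_mem_nonpendants
  rcases Nat.eq_or_lt_of_le hN.card_pos with h1 | h2
  · obtain ⟨v, hv⟩ := Finset.card_eq_one.1 h1.symm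
    have merge := MergesInto.singleton g (fun v => (degreeIn G (nonpendants G) v : ℝ))
      (hd v (by simp [hv]))
    simpa [hv, degreeIn, Finset.filter_singleton] using merge
  have pos (v : V) (hv : v ∈ nonpendants G) := one_le_degreeIn_nonpendants hG.1 h3 h2 hv
  rcases Nat.eq_zero_or_pos c with rfl | hc1
  · convert hG.mergesInto hg (Or.inl rfl) (by omega) hd fun u hu => Nat.cast_le.2 (pos u hu)
      using 1
    have inner_eq := hG.innerDegreeSum_nonpendants_add_two h3
    rw [innerDegreeSum] at inner_eq
    rify at inner_eq
    rw [Finset.sum_sub_distrib, Finset.sum_const, nsmul_eq_mul, Nat.cast_one]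
    linarith
  · have leaf := fun v => degreeIn_eq_one_of_mem_sdiff_core (v := v) pos
    have hunion := Finset.union_sdiff_of_subset (core_subset G (nonpendants G))
    have two_le_card : (2 : ℝ) ≤ (nonpendants G).card := by exact_mod_cast h2
    have merge := (hG.mergesInto_core_nonpendants hg h3 h2 hc1 hc).union hg (Or.inl rfl)
      (T := nonpendants G \ core G (nonpendants G)) (by push_cast; linarith)
      Finset.disjoint_sdiff (by rwa [hunion]) (fun u hu => by rw [leaf u hu])
      fun T hT ⟨u, hu⟩ => ⟨u, hu, (degreeIn_mono G (Finset.union_subset (core_subset _ _)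
        (hT.trans Finset.sdiff_subset)) u).trans (leaf u (hT hu)).le⟩
    have leaf_sum : ∑ u ∈ nonpendants G \ core G (nonpendants G),
        ((degreeIn G (nonpendants G) u : ℝ) - (1 : ℕ)) = 0 :=
      Finset.sum_eq_zero fun u hu => by rw [leaf u hu, sub_self]
    rwa [hunion, leaf_sum, add_zero] at merge

theorem mergesInto_nonpendants_hubDegree (hg : IsDiscreteGoodEscalating g)
    (hG : IsCyclicGraph c G) (hc : c ≤ 2) :
    MergesInto g G (fun v => degreeIn G (nonpendants G) v) (nonpendants G)
      (hubDegree G (nonpendants G)) := by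
  have hd : ∀ u ∈ nonpendants G, 2 ≤ G.degree u := fun _ => two_le_degree_of_mem_nonpendants
  have hub_eq : (hubDegree G (nonpendants G) : ℝ) =
      (2 : ℕ) + ∑ u ∈ nonpendants G, ((G.degree u : ℝ) - (2 : ℕ)) := by
    rw [hubDegree, Nat.cast_add, Nat.cast_sum]
    exact congrArg _ (Finset.sum_congr rfl fun u hu => Nat.cast_sub (hd u hu))
  rw [hub_eq]
  exact (mergeEnergy_mono hg.toIsDiscreteEscalating hd fun v _ =>
    Nat.cast_le.2 (degreeIn_le_degree G _ v)).trans
      (hG.mergesInto hg (Or.inr rfl) (by omega) hd fun u hu => Nat.cast_le.2 (hd u hu))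

end IsCyclicGraph

/-! ### Graphs with a single hub -/

/-- `G` maximizes the connectivity function among the `c`-cyclic graphs with `n` vertices and `k`
pendant vertices. For escalating `f` this is extremality; here `f` is only required to be
symmetric. -/
def IsMaximizer (f : ℝ → ℝ → ℝ) (hsymm : ∀ x y : ℝ, f x y = f y x) (c n k : ℕ)
    (G : SimpleGraph V) : Prop :=
  InClass c n k G ∧
    ∀ (W : Type) [Fintype W] (H : SimpleGraph W), InClass c n k H →
      connectivityFunction f hsymm H ≤ connectivityFunction f hsymm G

section Hub

variable {r : V}

theorem hubDegree_eq_degree (hr : r ∈ S) (hdr : 2 ≤ G.degree r)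
    (hS : ∀ v ∈ S, v ≠ r → G.degree v = 2) : hubDegree G S = G.degree r := by
  rw [hubDegree, Finset.sum_eq_single_of_mem r hr fun v hv hvr => by rw [hS v hv hvr, Nat.sub_self],
    Nat.add_sub_cancel' hdr]

theorem pairInteraction_eq_zero (hg : IsDiscreteEscalating g)
    (hS : ∀ v ∈ S, v ≠ r → G.degree v = 2) : pairInteraction g G S = 0 := by
  refine Finset.sum_eq_zero fun u hu => Finset.sum_eq_zero fun v hv => ?_
  obtain ⟨hvS, huv⟩ := Finset.mem_filter.1 hv
  by_cases hur : u = r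
  · rw [hS v hvS fun hvr => huv.ne (hur.trans hvr.symm), interaction_two_right]
  · rw [hS u hu hur, hg.interaction_two_left]

theorem mergeEnergy_eq_hubWeight (hg : IsDiscreteEscalating g) (hr : r ∈ S)
    (hdr : 2 ≤ G.degree r) (hS : ∀ v ∈ S, v ≠ r → G.degree v = 2) :
    mergeEnergy g G a S = hubWeight g (hubDegree G S) (a r) - 2 * g 2 2 := by
  rw [mergeEnergy, pairInteraction_eq_zero hg hS, zero_div, add_zero,
    hubDegree_eq_degree hr hdr hS]
  exact Finset.sum_eq_single_of_mem r hr fun v hv hvr => by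
    rw [hS v hv hvr, hubWeight_two, sub_self]

theorem isMaximizer_of_hub {f : ℝ → ℝ → ℝ} (hsymm : ∀ x y, f x y = f y x)
    (hf : IsDiscreteGoodEscalating (natRestriction f)) {c n k : ℕ} (hc : c ≤ 2) (hn : 3 ≤ n)
    (hG : InClass c n k G) (hr : r ∈ nonpendants G)
    (hother : ∀ v ∈ nonpendants G, v ≠ r → G.degree v = 2)
    (hneighbors : (∀ v, G.Adj r v → v ∈ nonpendants G) ∨
      ∀ v ∈ nonpendants G, v ≠ r → G.Adj r v) :
    IsMaximizer f hsymm c n k G := by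
  refine ⟨hG, fun W _ H hH => ?_⟩
  obtain ⟨hGc, rfl, rfl⟩ := hG
  obtain ⟨hHc, hcard, hpendant⟩ := hH
  have h3 : 3 ≤ Fintype.card W := hcard ▸ hn
  have hdr := two_le_degree_of_mem_nonpendants hr
  have card_eq : (nonpendants H).card = (nonpendants G).card := by
    have := card_nonpendants hGc.1 hn
    have := card_nonpendants hHc.1 h3
    omega
  have edges_eq : H.edgeFinset.card = G.edgeFinset.card := by
    have := hGc.2
    have := hHc.2
    omega
  have hub_eq : hubDegree H (nonpendants H) = hubDegree G (nonpendants G) := by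
    rw [hubDegree_nonpendants hHc h3, hubDegree_nonpendants hGc hn, hpendant]
  have merges : MergesInto (natRestriction f) H (fun v => degreeIn H (nonpendants H) v)
      (nonpendants H) (degreeIn G (nonpendants G) r) := by
    rcases hneighbors with hall | hall
    · rw [degreeIn_eq_degree hall, ← hubDegree_eq_degree hr hdr hother, ← hub_eq]
      exact hHc.mergesInto_nonpendants_hubDegree hf hc
    · rw [← add_sub_cancel_right (degreeIn G (nonpendants G) r : ℝ) 1, ← Nat.cast_add_one,
        degreeIn_add_one_eq_card hr hall, ← card_eq]
      exact hHc.mergesInto_nonpendants_card_sub_one hf h3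
        (Finset.card_pos.1 (card_eq ▸ Finset.card_pos.2 ⟨r, hr⟩)) hc
  rw [MergesInto, hub_eq] at merges
  rw [connectivityFunction_eq_mergeEnergy hsymm hf.toIsDiscreteEscalating hHc.1 h3,
    connectivityFunction_eq_mergeEnergy hsymm hf.toIsDiscreteEscalating hGc.1 hn,
    mergeEnergy_eq_hubWeight hf.toIsDiscreteEscalating hr hdr hother, card_eq, edges_eq, hpendant]
  linarith

end Hub

end Graphs

/-! ### Attaching paths -/

theorem sum_fin_ite_eq_val {n : ℕ} (m : ℕ) :
    (∑ j : Fin n, if m = j.val then 1 else 0) = if m < n then 1 else 0 := by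
  rw [Fin.sum_univ_eq_sum_range (fun j => if m = j then 1 else 0) n, Finset.sum_ite_eq]
  simp only [Finset.mem_range]

theorem sum_sigma_fin_ite_last {k : ℕ} {l : Fin k → ℕ} (hl : ∀ i, 1 ≤ l i) :
    (∑ p : Σ i : Fin k, Fin (l i), if p.2.val + 1 = l p.1 then 1 else 0) = k := by
  have one_last (i : Fin k) : (∑ j : Fin (l i), if j.val + 1 = l i then 1 else 0) = 1 := by
    have sum_eq := sum_fin_ite_eq_val (n := l i) (l i - 1)
    rw [if_pos (Nat.sub_one_lt_of_lt (hl i))] at sum_eq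
    refine (Finset.sum_congr rfl fun j _ => if_congr ?_ rfl rfl).trans sum_eq
    have := hl i
    omega
  rw [Fintype.sum_sigma, Finset.sum_congr rfl fun i _ => one_last i, Finset.sum_const,
    Finset.card_univ, Fintype.card_fin, smul_eq_mul, mul_one]

theorem AlmostEqualLengths.two_le_or_le_two {k : ℕ} {l : Fin k → ℕ} (hl : AlmostEqualLengths l) :
    (∀ i, 2 ≤ l i) ∨ ∀ i, l i ≤ 2 := by
  by_contra! h
  obtain ⟨⟨i, hi⟩, j, hj⟩ := h
  have := abs_le.1 (hl.2 i j)
  omega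

theorem exists_almostEqualLengths {k m : ℕ} (hk : 1 ≤ k) (hkm : k ≤ m) :
    ∃ l : Fin k → ℕ, AlmostEqualLengths l ∧ ∑ i, l i = m := by
  refine ⟨fun i => m / k + if i.val < m % k then 1 else 0, ⟨fun i => ?_, fun i j => ?_⟩, ?_⟩
  · exact Nat.le_add_right_of_le ((Nat.one_le_div_iff hk).2 hkm)
  · simp only [abs_le]
    split_ifs <;> push_cast <;> omega
  · have long_paths : (Finset.range k).filter (· < m % k) = Finset.range (m % k) := by
      ext i
      have := Nat.mod_lt m hk
      simp only [Finset.mem_filter, Finset.mem_range]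
      omega
    rw [Finset.sum_add_distrib, Fin.sum_univ_eq_sum_range (fun i => if i < m % k then 1 else 0) k,
      ← Finset.card_filter, long_paths, Finset.card_range, Finset.sum_const, Finset.card_univ,
      Fintype.card_fin, smul_eq_mul, Nat.div_add_mod]

section AttachPaths

open Classical

variable {V : Type*} {H : SimpleGraph V} {r : V} {k : ℕ} {l : Fin k → ℕ}

theorem connected_attachPaths (hH : H.Connected) : (attachPaths H r l).Connected := by
  have reach_path (i : Fin k) (m : ℕ) (hm : m < l i) :
      (attachPaths H r l).Reachable (.inl r) (.inr ⟨i, m, hm⟩) := by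
    induction m with
    | zero => exact SimpleGraph.Adj.reachable ⟨rfl, rfl⟩
    | succ m ih => exact (ih (by omega)).trans (SimpleGraph.Adj.reachable ⟨rfl, Or.inl rfl⟩)
  have reach : ∀ x, (attachPaths H r l).Reachable (.inl r) x
    | .inl u => (hH.preconnected r u).map (⟨Sum.inl, fun h => h⟩ : H →g attachPaths H r l)
    | .inr ⟨i, j⟩ => reach_path i j.1 j.2
  exact (SimpleGraph.connected_iff _).2 ⟨fun x y => (reach x).symm.trans (reach y), ⟨.inl r⟩⟩

variable [Fintype V]

theorem degree_eq_sum_ite_adj (G : SimpleGraph V) (v : V) :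
    G.degree v = ∑ w, if G.Adj v w then 1 else 0 :=
  G.degree_eq_sum_if_adj v

theorem degree_attachPaths_inl (hl : ∀ i, 1 ≤ l i) (u : V) :
    (attachPaths H r l).degree (.inl u) = H.degree u + if u = r then k else 0 := by
  have adj_path (i : Fin k) : (∑ j : Fin (l i),
      if (attachPaths H r l).Adj (.inl u) (.inr ⟨i, j⟩) then 1 else 0) =
      if u = r then 1 else 0 := by
    by_cases hu : u = r
    · have := sum_fin_ite_eq_val (n := l i) 0
      rw [if_pos (show 0 < l i from hl i)] at this
      simpa [attachPaths, hu, eq_comm] using this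
    · simp [attachPaths, hu]
  rw [degree_eq_sum_ite_adj, Fintype.sum_sum_type, degree_eq_sum_ite_adj H, Fintype.sum_sigma]
  congr 1
  simp only [adj_path]
  split_ifs <;> simp

theorem degree_attachPaths_inr (p : Σ i : Fin k, Fin (l i)) :
    (attachPaths H r l).degree (.inr p) = if p.2.val + 1 = l p.1 then 1 else 2 := by
  obtain ⟨i, j⟩ := p
  have adj_root : (∑ u, if (attachPaths H r l).Adj (.inr ⟨i, j⟩) (.inl u) then 1 else 0) =
      if j.val = 0 then 1 else 0 := by
    by_cases hj : j.val = 0 <;> simp [attachPaths, hj]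
  have adj_other_path (i' : Fin k) (hi' : i' ≠ i) : (∑ j' : Fin (l i'),
      if (attachPaths H r l).Adj (.inr ⟨i, j⟩) (.inr ⟨i', j'⟩) then 1 else 0) = 0 := by
    simp [attachPaths, hi'.symm]
  have adj_same_path : (∑ j' : Fin (l i),
      if (attachPaths H r l).Adj (.inr ⟨i, j⟩) (.inr ⟨i, j'⟩) then 1 else 0) =
      (if j.val + 1 < l i then 1 else 0) + if j.val = 0 then 0 else 1 := by
    have split (j' : Fin (l i)) :
        (if (attachPaths H r l).Adj (.inr ⟨i, j⟩) (.inr ⟨i, j'⟩) then 1 else 0) =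
        (if j.val + 1 = j'.val then 1 else 0) +
          if j.val = 0 then 0 else if j.val - 1 = j'.val then 1 else 0 := by
      simp only [attachPaths, true_and]
      split_ifs <;> omega
    simp only [split, Finset.sum_add_distrib, sum_fin_ite_eq_val]
    by_cases hj : j.val = 0
    · simp [hj]
    · simp only [hj, if_false, sum_fin_ite_eq_val, show j.val - 1 < l i by omega, if_true]
  rw [degree_eq_sum_ite_adj, Fintype.sum_sum_type, Fintype.sum_sigma, adj_root,
    Finset.sum_eq_single_of_mem i (Finset.mem_univ i) fun i' _ => adj_other_path i', adj_same_path]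
  dsimp only
  have := j.isLt
  split_ifs <;> omega

theorem sum_degree_attachPaths_inr (hl : ∀ i, 1 ≤ l i) :
    ∑ p, (attachPaths H r l).degree (.inr p) + k = 2 * ∑ i, l i := by
  have degree_add (p : Σ i : Fin k, Fin (l i)) : (attachPaths H r l).degree (.inr p) +
      (if p.2.val + 1 = l p.1 then 1 else 0) = 2 := by
    rw [degree_attachPaths_inr]
    split_ifs <;> rfl
  calc ∑ p, (attachPaths H r l).degree (.inr p) + k
      = ∑ p : Σ i : Fin k, Fin (l i), 2 := by
        rw [← Finset.sum_congr rfl fun p _ => degree_add p, Finset.sum_add_distrib,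
          sum_sigma_fin_ite_last hl]
    _ = 2 * ∑ i, l i := by
        simp only [Finset.sum_const, Finset.card_univ, Fintype.card_sigma, Fintype.card_fin,
          smul_eq_mul, mul_comm]

theorem card_attachPaths (l : Fin k → ℕ) :
    Fintype.card (V ⊕ Σ i : Fin k, Fin (l i)) = Fintype.card V + ∑ i, l i := by
  simp only [Fintype.card_sum, Fintype.card_sigma, Fintype.card_fin]

theorem isCyclicGraph_attachPaths {c : ℕ} (hl : ∀ i, 1 ≤ l i) (hH : IsCyclicGraph c H) :
    IsCyclicGraph c (attachPaths H r l) := by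
  refine ⟨connected_attachPaths hH.1, ?_⟩
  have degree_sum := (attachPaths H r l).sum_degrees_eq_twice_card_edges
  rw [Fintype.sum_sum_type] at degree_sum
  simp only [degree_attachPaths_inl hl, Finset.sum_add_distrib,
    H.sum_degrees_eq_twice_card_edges, Finset.sum_ite_eq', Finset.mem_univ, if_true] at degree_sum
  have := sum_degree_attachPaths_inr (H := H) (r := r) hl
  have := hH.2
  rw [card_attachPaths]
  omega

theorem pendantCount_attachPaths (hl : ∀ i, 1 ≤ l i)
    (hH : ∀ u, 2 ≤ (attachPaths H r l).degree (.inl u)) :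
    pendantCount (attachPaths H r l) = k := by
  rw [pendantCount, Finset.card_filter, Fintype.sum_sum_type,
    Finset.sum_eq_zero fun u _ => if_neg (by have := hH u; omega), zero_add]
  refine (Finset.sum_congr rfl fun p _ => ?_).trans (sum_sigma_fin_ite_last hl)
  rw [degree_attachPaths_inr]
  split_ifs <;> simp_all

/-- `H` consists of `c` triangles sharing the vertex `r`. This is encoded by the number of vertices
and by the neighbours of `r` being all other vertices, each of degree `2`. -/
structure IsWindmill (c : ℕ) (H : SimpleGraph V) (r : V) : Prop where
  card_eq : Fintype.card V = 2 * c + 1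
  adj : ∀ u, u ≠ r → H.Adj r u
  degree_eq_two : ∀ u, u ≠ r → H.degree u = 2

namespace IsWindmill

variable {c : ℕ}

theorem degree_center (hH : IsWindmill c H r) : H.degree r = 2 * c := by
  have := degreeIn_add_one_eq_card (Finset.mem_univ r) fun u _ => hH.adj u
  rw [degreeIn_univ, Finset.card_univ, hH.card_eq] at this
  exact Nat.add_right_cancel this

theorem connected (hH : IsWindmill c H r) : H.Connected := by
  have reach (u : V) : H.Reachable r u := by
    rcases eq_or_ne u r with rfl | hu
    exacts [.rfl, (hH.adj u hu).reachable]
  exact (SimpleGraph.connected_iff _).2 ⟨fun u v => (reach u).symm.trans (reach v), ⟨r⟩⟩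

theorem isCyclicGraph (hH : IsWindmill c H r) : IsCyclicGraph c H := by
  refine ⟨hH.connected, ?_⟩
  have degree_sum := H.sum_degrees_eq_twice_card_edges
  rw [← Finset.add_sum_erase _ _ (Finset.mem_univ r), hH.degree_center,
    Finset.sum_congr rfl fun u hu => hH.degree_eq_two u (Finset.ne_of_mem_erase hu),
    Finset.sum_const, Finset.card_erase_of_mem (Finset.mem_univ r), Finset.card_univ, smul_eq_mul,
    hH.card_eq] at degree_sum
  rw [hH.card_eq]
  omega

theorem degree_attachPaths_inl_of_ne (hH : IsWindmill c H r) (hl : ∀ i, 1 ≤ l i) {u : V}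
    (hu : u ≠ r) : (attachPaths H r l).degree (.inl u) = 2 := by
  rw [degree_attachPaths_inl hl, hH.degree_eq_two u hu, if_neg hu]

theorem two_le_degree_attachPaths_inl (hH : IsWindmill c H r) (hl : ∀ i, 1 ≤ l i)
    (hkc : 2 ≤ k + 2 * c) (u : V) : 2 ≤ (attachPaths H r l).degree (.inl u) := by
  rcases eq_or_ne u r with rfl | hu
  · rwa [degree_attachPaths_inl hl, hH.degree_center, if_pos rfl, add_comm]
  · exact (hH.degree_attachPaths_inl_of_ne hl hu).ge

theorem inClass_attachPaths (hH : IsWindmill c H r) (hl : ∀ i, 1 ≤ l i)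
    (hkc : 2 ≤ k + 2 * c) : InClass c (2 * c + 1 + ∑ i, l i) k (attachPaths H r l) :=
  ⟨isCyclicGraph_attachPaths hl hH.isCyclicGraph, by rw [card_attachPaths, hH.card_eq],
    pendantCount_attachPaths hl (hH.two_le_degree_attachPaths_inl hl hkc)⟩

theorem degree_eq_two_of_mem_nonpendants (hH : IsWindmill c H r) (hl : ∀ i, 1 ≤ l i) :
    ∀ v ∈ nonpendants (attachPaths H r l), v ≠ .inl r → (attachPaths H r l).degree v = 2
  | .inl _, _, hv => hH.degree_attachPaths_inl_of_ne hl fun h => hv (congrArg _ h)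
  | .inr p, hp, _ => by
    have := two_le_degree_of_mem_nonpendants hp
    rw [degree_attachPaths_inr] at this ⊢
    split_ifs at this ⊢ <;> omega

theorem mem_nonpendants_of_adj_center (hH : IsWindmill c H r) (hl : ∀ i, 2 ≤ l i)
    (hkc : 2 ≤ k + 2 * c) :
    ∀ v, (attachPaths H r l).Adj (.inl r) v → v ∈ nonpendants (attachPaths H r l)
  | .inl u, _ => Finset.mem_filter.2 ⟨Finset.mem_univ _,
      hH.two_le_degree_attachPaths_inl (fun i => one_le_two.trans (hl i)) hkc u⟩
  | .inr p, hp => by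
    have first : p.2.val = 0 := hp.2
    have := hl p.1
    rw [nonpendants, Finset.mem_filter, degree_attachPaths_inr, if_neg (by omega)]
    exact ⟨Finset.mem_univ _, le_rfl⟩

theorem adj_center_of_mem_nonpendants (hH : IsWindmill c H r) (hl : ∀ i, l i ≤ 2) :
    ∀ v ∈ nonpendants (attachPaths H r l), v ≠ .inl r → (attachPaths H r l).Adj (.inl r) v
  | .inl u, _, hv => hH.adj u fun h => hv (congrArg _ h)
  | .inr p, hp, _ => by
    have hdeg := two_le_degree_of_mem_nonpendants hp
    rw [degree_attachPaths_inr] at hdeg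
    have first : p.2.val = 0 := by
      have := hl p.1
      have := p.2.isLt
      split_ifs at hdeg <;> omega
    exact ⟨rfl, first⟩

theorem isMaximizer_attachPaths {f : ℝ → ℝ → ℝ} (hsymm : ∀ x y, f x y = f y x)
    (hf : IsDiscreteGoodEscalating (natRestriction f)) (hc : c ≤ 2) (hH : IsWindmill c H r)
    (hkc : 2 ≤ k + 2 * c) (hl : AlmostEqualLengths l) {n : ℕ}
    (hn : 2 * c + 1 + ∑ i, l i = n) : IsMaximizer f hsymm c n k (attachPaths H r l) := by
  subst hn
  have k_le_sum : k ≤ ∑ i, l i := by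
    simpa using Finset.card_nsmul_le_sum Finset.univ l 1 fun i _ => hl.1 i
  exact isMaximizer_of_hub hsymm hf hc (by omega) (hH.inClass_attachPaths hl.1 hkc)
    (Finset.mem_filter.2 ⟨Finset.mem_univ _, hH.two_le_degree_attachPaths_inl hl.1 hkc r⟩)
    (hH.degree_eq_two_of_mem_nonpendants hl.1)
    (hl.two_le_or_le_two.imp (fun h => hH.mem_nonpendants_of_adj_center h hkc)
      hH.adj_center_of_mem_nonpendants)

end IsWindmill

theorem isWindmill_bowtie : IsWindmill 2 bowtie 0 where
  card_eq := rfl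
  adj u hu := by fin_cases u <;> simp_all [bowtie]
  degree_eq_two u hu := by
    rw [degree_eq_sum_ite_adj, Fin.sum_univ_five]
    fin_cases u <;> simp_all [bowtie]

theorem isWindmill_cycleGraph_three (v : Fin 3) : IsWindmill 1 (SimpleGraph.cycleGraph 3) v where
  card_eq := rfl
  adj u hu := by
    rw [SimpleGraph.cycleGraph_three_eq_top]
    exact hu.symm
  degree_eq_two u _ := by
    rw [SimpleGraph.cycleGraph_three_eq_top, degree_eq_sum_ite_adj, Fin.sum_univ_three]
    fin_cases u <;> simp

theorem isWindmill_bot : IsWindmill 0 (⊥ : SimpleGraph (Fin 1)) 0 where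
  card_eq := rfl
  adj u hu := absurd (Subsingleton.elim u 0) hu
  degree_eq_two u hu := absurd (Subsingleton.elim u 0) hu

end AttachPaths

theorem mainTheorem9_general (f : ℝ → ℝ → ℝ) (hsymm : ∀ x y : ℝ, f x y = f y x)
    (hf : IsDiscreteGoodEscalating (natRestriction f)) (n k : ℕ) (hk : 1 ≤ k) :
    (k + 5 ≤ n →
      (∃ l : Fin k → ℕ, AlmostEqualLengths l ∧ 5 + ∑ i, l i = n) ∧
      ∀ l : Fin k → ℕ, AlmostEqualLengths l → 5 + ∑ i, l i = n →
        IsMaximizer f hsymm 2 n k (attachPaths bowtie 0 l)) ∧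
    (k + 3 ≤ n →
      (∃ l : Fin k → ℕ, AlmostEqualLengths l ∧ 3 + ∑ i, l i = n) ∧
      ∀ l : Fin k → ℕ, AlmostEqualLengths l → 3 + ∑ i, l i = n → ∀ v : Fin 3,
        IsMaximizer f hsymm 1 n k (attachPaths (SimpleGraph.cycleGraph 3) v l)) ∧
    (2 ≤ k → k + 1 ≤ n →
      (∃ l : Fin k → ℕ, AlmostEqualLengths l ∧ 1 + ∑ i, l i = n) ∧
      ∀ l : Fin k → ℕ, AlmostEqualLengths l → 1 + ∑ i, l i = n →
        IsMaximizer f hsymm 0 n k (attachPaths (⊥ : SimpleGraph (Fin 1)) 0 l)) := by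
  have exists_lengths (b : ℕ) (hb : k + b ≤ n) :
      ∃ l : Fin k → ℕ, AlmostEqualLengths l ∧ b + ∑ i, l i = n := by
    obtain ⟨l, hl, hsum⟩ := exists_almostEqualLengths hk (Nat.le_sub_of_add_le hb)
    exact ⟨l, hl, by omega⟩
  refine ⟨fun h => ⟨exists_lengths 5 h, fun l hl hn => ?_⟩,
    fun h => ⟨exists_lengths 3 h, fun l hl hn v => ?_⟩,
    fun hk2 h => ⟨exists_lengths 1 h, fun l hl hn => ?_⟩⟩
  · exact isWindmill_bowtie.isMaximizer_attachPaths hsymm hf le_rfl (by omega) hl hn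
  · exact (isWindmill_cycleGraph_three v).isMaximizer_attachPaths hsymm hf one_le_two (by omega)
      hl hn
  · exact isWindmill_bot.isMaximizer_attachPaths hsymm hf zero_le_two (by omega) hl hn

theorem mainTheorem9 (f : ℝ → ℝ → ℝ) (hf : IsGoodEscalating f) (n k : ℕ) (hk : 1 ≤ k) :
    -- bicyclic graphs: the graph `F''_n(k)` exists and is extremal
    (k + 5 ≤ n →
      (∃ l : Fin k → ℕ, AlmostEqualLengths l ∧ 5 + ∑ i, l i = n) ∧
      ∀ l : Fin k → ℕ, AlmostEqualLengths l → 5 + ∑ i, l i = n →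
        IsExtremalGraph hf.toIsEscalating 2 n k (attachPaths bowtie 0 l)) ∧
    -- unicyclic graphs: the graph `F'_n(k)` exists and is extremal
    (k + 3 ≤ n →
      (∃ l : Fin k → ℕ, AlmostEqualLengths l ∧ 3 + ∑ i, l i = n) ∧
      ∀ l : Fin k → ℕ, AlmostEqualLengths l → 3 + ∑ i, l i = n → ∀ v : Fin 3,
        IsExtremalGraph hf.toIsEscalating 1 n k (attachPaths (SimpleGraph.cycleGraph 3) v l)) ∧
    -- trees: the graph `F_n(k)` exists and is extremal
    (2 ≤ k → k + 1 ≤ n →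
      (∃ l : Fin k → ℕ, AlmostEqualLengths l ∧ 1 + ∑ i, l i = n) ∧
      ∀ l : Fin k → ℕ, AlmostEqualLengths l → 1 + ∑ i, l i = n →
        IsExtremalGraph hf.toIsEscalating 0 n k (attachPaths (⊥ : SimpleGraph (Fin 1)) 0 l)) :=
  mainTheorem9_general f hf.symm hf.discrete n k hk
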